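/- Conventions. For a poset $P$ and $A \subseteq P$, two points of $A$ are connected in $A$ if they can be joined by a finite sequence of points of $A$ in which any two successive points are comparable. For posets $P, R$ let $\mathcal{H}(P,R)$ be the set of order-preserving maps; for $\xi \in \mathcal{H}(P,R)$ and $x \in P$ let $G_\xi(x)$ be the set of all points connected with $x$ in $\xi^{-1}(\xi(x))$. The EV-system of $P$ is $\mathcal{E}(P) = \{(x,D,U) : x \in P,\ D \subseteq \{y : y < x\},\ U \subseteq \{y : y > x\}\}$; components of $\mathfrak{a} \in \mathcal{E}(P)$ are written $\mathfrak{a}_1, \mathfrak{a}_2, \mathfrak{a}_3$. On it, $\mathfrak{a} <_+ \mathfrak{b}$ means $\mathfrak{a}_1 \in \mathfrak{b}_2$ and $\mathfrak{b}_1 \in \mathfrak{a}_3$, and $\le_+$ is the reflexive closure of $<_+$; a homomorphism between EV-systems is a map preserving $\le_+$. For $\xi \in \mathcal{H}(P,R)$ and $x \in P$ put $\alpha_{P,\xi}(x) = (\xi(x), \xi(D_x), \xi(U_x)) \in \mathcal{E}(R)$, where $D_x$ (resp. $U_x$) is the set of points outside $G_\xi(x)$ that lie below (resp. above) some point of $G_\xi(x)$.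 Fix a representation system $\mathfrak{P}_r$ of the isomorphism classes of non-empty finite posets. A strong I-scheme from $R$ to $S$ is a family of injective maps $\rho_P : \mathcal{H}(P,R) \to \mathcal{H}(P,S)$, $P \in \mathfrak{P}_r$, such that for all $P, P' \in \mathfrak{P}_r$, $\xi \in \mathcal{H}(P,R)$, $\zeta \in \mathcal{H}(P',R)$, $x \in P$, $y \in P'$: $\alpha_{P,\xi}(x) \le_+ \alpha_{P',\zeta}(y)$ implies $\alpha_{P,\rho_P(\xi)}(x) \le_+ \alpha_{P',\rho_{P'}(\zeta)}(y)$, and likewise with $<_+$ in place of $\le_+$ on both sides. Write $R \sqsubseteq_I S$ if one exists. Say that a homomorphism $\epsilon : \mathcal{E}(R) \to \mathcal{E}(S)$ realises $R \sqsubseteq_I S$ if it is injective and, with $\eta_P(\xi)(x) = \epsilon(\alpha_{P,\xi}(x))_1$ (which defines $\eta_P(\xi) \in \mathcal{H}(P,S)$), one has $\alpha_{P,\eta_P(\xi)}(x) = \epsilon(\alpha_{P,\xi}(x))$ for all $P \in \mathfrak{P}_r$, $\xi \in \mathcal{H}(P,R)$, $x \in P$; then $\eta$ is a strong I-scheme from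 $R$ to $S$. Theorem 6. Let $Q, R, S$ be non-empty finite posets, the carrier $Y$ of $Q$ being disjoint from the carrier $X$ of $R$ and from the carrier of $S$, and let $\oplus$ denote the ordinal sum (left summand below right summand). Let the homomorphism $\epsilon : \mathcal{E}(Q \oplus R) \to \mathcal{E}(Q \oplus S)$ realise $Q \oplus R \sqsubseteq_I Q \oplus S$, and suppose that $Y \subseteq \{\epsilon(\mathfrak{a})_1 : \mathfrak{a} \in \mathcal{E}(Q)^*\}$, where $\mathcal{E}(Q)^* = \{(x, D, U \cup X) : (x,D,U) \in \mathcal{E}(Q)\} \subseteq \mathcal{E}(Q \oplus R)$. Then $R \sqsubseteq_I S$. Explicitly, let $r : \mathcal{E}(R) \to \mathcal{E}(Q \oplus R)$, $(x,D,U) \mapsto (x, D \cup Y, U)$, and $s(x,D,U) = (x, D \setminus Y, U) \in \mathcal{E}(S)$ for $(x,D,U) \in \mathcal{E}(Q \oplus S)$ with $x \in S$. Then $\epsilon(r(\mathfrak{a}))_1 \in S$ for every $\mathfrak{a} \in \mathcal{E}(R)$, so that $T = s \circ \epsilon \circ r : \mathcal{E}(R) \to \mathcal{E}(S)$ is well defined,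 and $T$ is an injective homomorphism that realises $R \sqsubseteq_I S$. -/

import Mathlib

universe u v w

namespace HomSchemes

/-! ### Representation systems of the non-empty finite posets -/

/-- `𝔓` is a representation system of the non-empty finite posets: it consists of non-empty finite
posets and contains exactly one poset from every isomorphism class. -/
structure IsRepSystem (𝔓 : Set FinPartOrd.{u}) : Prop where
  nonempty : ∀ P ∈ 𝔓, Nonempty P
  exists_iso : ∀ X : FinPartOrd.{u}, Nonempty X → ∃ P ∈ 𝔓, Nonempty (X ≃o P)
  eq_of_iso : ∀ P ∈ 𝔓, ∀ P' ∈ 𝔓, Nonempty (P ≃o P') → P = P'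

/-- Representation systems exist. -/
theorem exists_isRepSystem : ∃ 𝔓 : Set FinPartOrd.{u}, IsRepSystem 𝔓 := by
  let st : Setoid FinPartOrd.{u} :=
    { r := fun X Y => Nonempty (X ≃o Y)
      iseqv := ⟨fun X => ⟨OrderIso.refl X⟩, fun ⟨e⟩ => ⟨e.symm⟩,
        fun ⟨e⟩ ⟨f⟩ => ⟨e.trans f⟩⟩ }
  refine ⟨{P | Nonempty P ∧ (Quotient.mk st P).out = P}, ?_, ?_, ?_⟩
  · rintro P ⟨h, -⟩
    exact h
  · rintro X ⟨x⟩
    obtain ⟨e⟩ : Nonempty ((Quotient.mk st X).out ≃o X) := Quotient.mk_out (s := st) X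
    exact ⟨(Quotient.mk st X).out, ⟨⟨e.symm x⟩, by rw [Quotient.out_eq]⟩, ⟨e.symm⟩⟩
  · rintro P ⟨-, hP⟩ P' ⟨-, hP'⟩ h
    rw [← hP, ← hP', Quotient.sound (s := st) h]

/-! ### Connectivity -/

section Connectivity

variable {P : Type u} [PartialOrder P]

/-- `x` and `y` are connected in `A`: both lie in `A`, and a zigzag line inside `A` joins them. -/
def ConnectedIn (A : Set P) (x y : P) : Prop :=
  x ∈ A ∧ y ∈ A ∧
    Relation.ReflTransGen (fun a b => a ∈ A ∧ b ∈ A ∧ (a < b ∨ b < a)) x y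

/-- `γ_A(x)`, the set of the points connected with `x` in `A`. -/
def component (A : Set P) (x : P) : Set P := {y | ConnectedIn A x y}

/-- `G_ξ(x)`, the component of `x` in the fibre of `ξ` through `x`. -/
def fibreComponent {Y : Type v} (ξ : P → Y) (x : P) : Set P :=
  component (ξ ⁻¹' {ξ x}) x

/-- The punctured down-set of `A`: the points below some point of `A` which are not in `A`. -/
def puncturedDown (A : Set P) : Set P := {y | ∃ a ∈ A, y ≤ a} \ A

/-- The punctured up-set of `A`. -/
def puncturedUp (A : Set P) : Set P := {y | ∃ a ∈ A, a ≤ y} \ A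

end Connectivity

/-! ### EV-systems -/

/-- The EV-system of `P`: triples of a point `x`, a set of points strictly below `x`, and a set of
points strictly above `x`. -/
@[ext]
structure EV (P : Type u) [PartialOrder P] where
  /-- the first component -/
  pt : P
  /-- the second component -/
  dn : Set P
  /-- the third component -/
  up : Set P
  dn_sub : dn ⊆ Set.Iio pt
  up_sub : up ⊆ Set.Ioi pt

/-- The relation `<₊` on the EV-system. -/
instance {P : Type u} [PartialOrder P] : LT (EV P) := ⟨fun a b => a.pt ∈ b.dn ∧ b.pt ∈ a.up⟩

/-- The relation `≤₊` on the EV-system, the reflexive closure of `<₊` (not transitive in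
general). -/
instance {P : Type u} [PartialOrder P] : LE (EV P) := ⟨fun a b => a < b ∨ a = b⟩

/-- Homomorphisms between EV-systems: mappings preserving `≤₊`. -/
abbrev EVHom (R : Type u) (S : Type v) [PartialOrder R] [PartialOrder S] :=
  (fun a b : EV R => a ≤ b) →r (fun a b : EV S => a ≤ b)

section Alpha

variable {P : Type u} {R : Type v} {S : Type w} [PartialOrder P] [PartialOrder R] [PartialOrder S]

theorem self_mem_fibreComponent {Y : Type v} (ξ : P → Y) (x : P) : x ∈ fibreComponent ξ x :=
  ⟨rfl, rfl, Relation.ReflTransGen.refl⟩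

theorem map_eq_of_mem {Y : Type v} {ξ : P → Y} {x y : P} (h : y ∈ fibreComponent ξ x) :
    ξ y = ξ x := h.2.1

theorem mem_of_comparable {Y : Type v} {ξ : P → Y} {x y z : P} (hy : y ∈ fibreComponent ξ x)
    (hz : ξ z = ξ x) (h : y < z ∨ z < y) : z ∈ fibreComponent ξ x :=
  ⟨hy.1, hz, hy.2.2.tail ⟨hy.2.1, hz, h⟩⟩

theorem fibreComponent_subset {Y : Type v} {ξ : P → Y} {x y : P} (h : y ∈ fibreComponent ξ x) :
    fibreComponent ξ y ⊆ fibreComponent ξ x := by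
  have he := map_eq_of_mem h
  rintro z ⟨_, hz, hyz⟩
  refine ⟨h.1, ?_, h.2.2.trans ?_⟩
  · rw [he] at hz
    exact hz
  · rw [he] at hyz
    exact hyz

theorem mem_fibreComponent_symm {Y : Type v} {ξ : P → Y} {x y : P}
    (h : y ∈ fibreComponent ξ x) : x ∈ fibreComponent ξ y := by
  have he := map_eq_of_mem h
  refine ⟨rfl, he.symm, ?_⟩
  rw [he]
  have h3 := h.2.2
  clear h he
  generalize ξ x = c at h3
  induction h3 with
  | refl => exact Relation.ReflTransGen.refl
  | tail _ hab ih => exact ih.head ⟨hab.2.1, hab.1, hab.2.2.symm⟩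

theorem fibreComponent_eq {Y : Type v} {ξ : P → Y} {x y : P} (h : y ∈ fibreComponent ξ x) :
    fibreComponent ξ y = fibreComponent ξ x :=
  (fibreComponent_subset h).antisymm (fibreComponent_subset (mem_fibreComponent_symm h))

/-- `α_{P,ξ}(x) = (ξ(x), ξ(D), ξ(U))`, where `D` and `U` are the punctured down-set and the
punctured up-set of `G_ξ(x)`. -/
def alpha (ξ : P →o R) (x : P) : EV R where
  pt := ξ x
  dn := ξ '' puncturedDown (fibreComponent ξ x)
  up := ξ '' puncturedUp (fibreComponent ξ x)
  dn_sub := by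
    rintro _ ⟨y, ⟨⟨g, hg, hyg⟩, hy⟩, rfl⟩
    have h1 : ξ y ≤ ξ x := map_eq_of_mem hg ▸ ξ.monotone hyg
    refine lt_of_le_of_ne h1 fun h2 => hy (mem_of_comparable hg h2 (Or.inr ?_))
    exact lt_of_le_of_ne hyg (by rintro rfl; exact hy hg)
  up_sub := by
    rintro _ ⟨y, ⟨⟨g, hg, hyg⟩, hy⟩, rfl⟩
    have h1 : ξ x ≤ ξ y := map_eq_of_mem hg ▸ ξ.monotone hyg
    refine lt_of_le_of_ne h1 fun h2 => hy (mem_of_comparable hg h2.symm (Or.inl ?_))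
    exact lt_of_le_of_ne hyg (by rintro rfl; exact hy hg)

/-- `α_{P,ξ}` is a homomorphism from `P` to the EV-system of `R`. -/
theorem alpha_mono (ξ : P →o R) {x y : P} (h : x ≤ y) : alpha ξ x ≤ alpha ξ y := by
  by_cases hm : x ∈ fibreComponent ξ y
  · right
    apply EV.ext
    · exact (map_eq_of_mem hm : ξ x = ξ y)
    · simp only [alpha, fibreComponent_eq hm]
    · simp only [alpha, fibreComponent_eq hm]
  · left
    refine ⟨⟨x, ⟨⟨y, self_mem_fibreComponent ξ y, h⟩, hm⟩, rfl⟩,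
      ⟨y, ⟨⟨x, self_mem_fibreComponent ξ x, h⟩, fun hy => hm (mem_fibreComponent_symm hy)⟩, rfl⟩⟩

theorem EV.pt_mono {a b : EV R} (h : a ≤ b) : a.pt ≤ b.pt := by
  rcases h with h | rfl
  · exact le_of_lt (b.dn_sub h.1)
  · exact le_rfl

/-- The homomorphism `η(ξ)` defined by a homomorphism `ε` between EV-systems:
`η(ξ)(x) = ε(α_{P,ξ}(x))₁`. -/
def eta (ε : EVHom R S) (ξ : P →o R) : P →o S where
  toFun x := (ε (alpha ξ x)).pt
  monotone' _ _ h := EV.pt_mono (ε.map_rel (alpha_mono ξ h))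

end Alpha

/-! ### Hom-schemes -/

section Schemes

variable (𝔓 : Set FinPartOrd.{u}) {R : Type v} {S : Type w} [PartialOrder R] [PartialOrder S]

/-- Hom-schemes from `R` to `S`: a mapping `H(P,R) → H(P,S)` for every `P ∈ 𝔓`. -/
abbrev HomScheme (R : Type v) (S : Type w) [PartialOrder R] [PartialOrder S] :=
  ∀ P : 𝔓, (P.1 →o R) → (P.1 →o S)

variable {𝔓} in
/-- The Hom-scheme `ρ` is strong: every `ρ_P` is one-to-one. -/
def HomScheme.IsStrong (ρ : HomScheme 𝔓 R S) : Prop :=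
  ∀ P : 𝔓, Function.Injective (ρ P)

variable {𝔓} in
/-- The Hom-scheme `ρ` is an I-scheme (image-controlled). -/
def HomScheme.IsIScheme (ρ : HomScheme 𝔓 R S) : Prop :=
  ∀ (P P' : 𝔓) (ξ : P.1 →o R) (ζ : P'.1 →o R) (x : P.1) (y : P'.1),
    (alpha ξ x ≤ alpha ζ y → alpha (ρ P ξ) x ≤ alpha (ρ P' ζ) y) ∧
    (alpha ξ x < alpha ζ y → alpha (ρ P ξ) x < alpha (ρ P' ζ) y)

/-- `R ⊑_I S`: there is a strong I-scheme from `R` to `S`. -/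
def StrongILE (R : Type v) (S : Type w) [PartialOrder R] [PartialOrder S] : Prop :=
  ∃ ρ : HomScheme 𝔓 R S, ρ.IsStrong ∧ ρ.IsIScheme

/-- The homomorphism `ε` between the EV-systems of `R` and `S` is one-to-one and satisfies
`α_{P,η(ξ)}(x) = ε(α_{P,ξ}(x))` for all `P ∈ 𝔓`, `ξ ∈ H(P,R)`, `x ∈ P`. -/
def RealisesI (ε : EVHom R S) : Prop :=
  Function.Injective ε ∧
    ∀ (P : 𝔓) (ξ : P.1 →o R) (x : P.1), alpha (eta ε ξ) x = ε (alpha ξ x)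

end Schemes

/-! ### Ordinal sums

The ordinal sum of `Q` and `R` is `Q ⊕ₗ R`; the parts of its carrier coming from `Q` and `R` are
`Set.range Sum.inlₗ` and `Set.range Sum.inrₗ`. -/

section OrdinalSum

variable {Q : Type u} {R : Type v} [PartialOrder Q] [PartialOrder R]

/-- The subset `E(Q)* = {(x, D, U ∪ X) | (x, D, U) ∈ E(Q)}` of the EV-system of the ordinal sum of
`Q` and `R`, where `X` is the carrier of `R`. -/
def starLeft (Q : Type u) (R : Type v) [PartialOrder Q] [PartialOrder R] : Set (EV (Q ⊕ₗ R)) :=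
  {a | ∃ b : EV Q, a.pt = Sum.inlₗ b.pt ∧ a.dn = Sum.inlₗ '' b.dn ∧
    a.up = Sum.inlₗ '' b.up ∪ Set.range Sum.inrₗ}

/-- The mapping `r : (x, D, U) ↦ (x, D ∪ Y, U)` from the EV-system of `R` to the EV-system of the
ordinal sum of `Q` and `R`, where `Y` is the carrier of `Q`. -/
def extendR (Q : Type u) {R : Type v} [PartialOrder Q] [PartialOrder R] (a : EV R) :
    EV (Q ⊕ₗ R) where
  pt := Sum.inrₗ a.pt
  dn := Sum.inrₗ '' a.dn ∪ Set.range Sum.inlₗ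
  up := Sum.inrₗ '' a.up
  dn_sub := by
    rintro _ (⟨y, hy, rfl⟩ | ⟨y, rfl⟩)
    · exact Sum.Lex.inr_lt_inr_iff.2 (a.dn_sub hy)
    · exact Sum.Lex.inl_lt_inr _ _
  up_sub := by
    rintro _ ⟨y, hy, rfl⟩
    exact Sum.Lex.inr_lt_inr_iff.2 (a.up_sub hy)

/-- The mapping `s : (x, D, U) ↦ (x, D \ Y, U)` to the EV-system of the right summand `R`, where `Y`
is the carrier of `Q`. It is defined for the triples with `x` in the right summand; for them, `U` is
contained in the right summand, too. The preimage under `Sum.inrₗ` removes the part in `Y`. -/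
noncomputable def restrictS
    (a : {a : EV (Q ⊕ₗ R) // a.pt ∈ Set.range (Sum.inrₗ : R → Q ⊕ₗ R)}) : EV R where
  pt := a.2.choose
  dn := Sum.inrₗ ⁻¹' a.1.dn
  up := Sum.inrₗ ⁻¹' a.1.up
  dn_sub := by
    intro y hy
    have h := a.1.dn_sub hy
    rw [← a.2.choose_spec] at h
    exact Sum.Lex.inr_lt_inr_iff.1 h
  up_sub := by
    intro y hy
    have h := a.1.up_sub hy
    rw [← a.2.choose_spec] at h
    exact Sum.Lex.inr_lt_inr_iff.1 h

end OrdinalSum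

end HomSchemes

open HomSchemes

/-! Every element of `starLeft Q R` is `<`-below every `extendR Q b`, and the injective `ε`
preserves `<`. Hence each point of `Q`, being the first component of some `ε a` with `a` in
`starLeft Q R`, lies in the second component of `ε (extendR Q b)`. This forces the first component
of that triple into `S`, and on such triples `extendR` undoes `restrictS`. So `T = s ∘ ε ∘ r`
satisfies `r ∘ T = ε ∘ r`, and injectivity and monotonicity of `T` follow from those of `ε`.

For realisation, extend `ξ : P →o R` by the identity of `Q` to a map on `Q ⊕ₗ P`. At points of `P`
its `alpha` is `r` of that of `ξ` (`alpha_liftRight`). Its image under `eta ε` restricts to `eta T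
ξ` on `P` and, by a counting argument, maps `Q` onto `Q`, so `alpha_inr` applies to it as well;
cancelling `r` gives the claim. Since `Q ⊕ₗ P` need not belong to `𝔓`, the realisation property is
first carried along isomorphisms. -/

namespace HomSchemes

/-! ### Invariance of `alpha` under isomorphism -/

section Transport

variable {P P' : Type*} [PartialOrder P] [PartialOrder P']

/-- Fibre components are transported along an order embedding whose range contains the fibre. -/
theorem fibreComponent_image {Y Y' : Type*} (f : P ↪o P') {g : Y → Y'}
    (hg : Function.Injective g) {ξ : P → Y} {ξ' : P' → Y'} (h : ∀ p, ξ' (f p) = g (ξ p)) (x : P)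
    (hf : ∀ p', ξ' p' = ξ' (f x) → p' ∈ Set.range f) :
    fibreComponent ξ' (f x) = f '' fibreComponent ξ x := by
  apply Set.Subset.antisymm
  · rintro z ⟨-, -, hz⟩
    induction hz with
    | refl => exact ⟨x, self_mem_fibreComponent ξ x, rfl⟩
    | @tail b c _ hbc ih =>
      obtain ⟨b, hb, rfl⟩ := ih
      obtain ⟨c, rfl⟩ := hf c hbc.2.1
      refine ⟨c, mem_of_comparable hb (hg ?_) ?_, rfl⟩
      · rw [← h, ← h]
        exact hbc.2.1
      · simpa only [f.lt_iff_lt] using hbc.2.2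
  · rintro _ ⟨z, ⟨-, -, hz⟩, rfl⟩
    induction hz with
    | refl => exact self_mem_fibreComponent ξ' (f x)
    | @tail b c _ hbc ih =>
      refine mem_of_comparable ih ?_ ?_
      · rw [h, h, show ξ c = ξ x from hbc.2.1]
      · simpa only [f.lt_iff_lt] using hbc.2.2

variable {R S : Type*} [PartialOrder R] [PartialOrder S]

theorem alpha_comp_orderIso (e : P ≃o P') (ξ : P' →o R) (x : P) :
    alpha (ξ.comp (e : P →o P')) x = alpha ξ (e x) := by
  have hG : fibreComponent ξ (e x) = e '' fibreComponent (ξ.comp (e : P →o P')) x :=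
    fibreComponent_image (ξ := ξ.comp (e : P →o P')) (ξ' := ξ) e.toOrderEmbedding
      Function.injective_id (fun _ => rfl) x
      fun p' _ => e.surjective p'
  apply EV.ext
  · rfl
  · ext r
    simp only [alpha, hG, puncturedDown, Set.mem_image, Set.mem_sdiff, Set.mem_ofPred_eq]
    constructor
    · rintro ⟨y, ⟨⟨a, ha, hya⟩, hy⟩, rfl⟩
      refine ⟨e y, ⟨⟨e a, ⟨a, ha, rfl⟩, e.monotone hya⟩, ?_⟩, rfl⟩
      rintro ⟨z, hz, hzy⟩
      exact hy (e.injective hzy ▸ hz)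
    · rintro ⟨y, ⟨⟨_, ⟨a, ha, rfl⟩, hya⟩, hy⟩, rfl⟩
      obtain ⟨y, rfl⟩ := e.surjective y
      exact ⟨y, ⟨⟨a, ha, e.le_iff_le.1 hya⟩, fun h => hy ⟨y, h, rfl⟩⟩, rfl⟩
  · ext r
    simp only [alpha, hG, puncturedUp, Set.mem_image, Set.mem_sdiff, Set.mem_ofPred_eq]
    constructor
    · rintro ⟨y, ⟨⟨a, ha, hya⟩, hy⟩, rfl⟩
      refine ⟨e y, ⟨⟨e a, ⟨a, ha, rfl⟩, e.monotone hya⟩, ?_⟩, rfl⟩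
      rintro ⟨z, hz, hzy⟩
      exact hy (e.injective hzy ▸ hz)
    · rintro ⟨y, ⟨⟨_, ⟨a, ha, rfl⟩, hya⟩, hy⟩, rfl⟩
      obtain ⟨y, rfl⟩ := e.surjective y
      exact ⟨y, ⟨⟨a, ha, e.le_iff_le.1 hya⟩, fun h => hy ⟨y, h, rfl⟩⟩, rfl⟩

end Transport

/-! ### Consequences of realisation -/

section Realisation

variable {R S : Type*} [PartialOrder R] [PartialOrder S]

theorem EV.ne_of_lt {a b : EV R} (h : a < b) : a ≠ b := by
  rintro rfl
  exact lt_irrefl _ (a.dn_sub h.1)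

/-- As `<` is irreflexive, injectivity rules out the equality case of `≤` for the images. -/
theorem EVHom.map_lt {ε : EVHom R S} (hε : Function.Injective ε) {a b : EV R} (h : a < b) :
    ε a < ε b :=
  (ε.map_rel (Or.inl h : a ≤ b)).resolve_right fun he => EV.ne_of_lt h (hε he)

/-- The defining property of a realising homomorphism holds for every non-empty finite poset. -/
theorem RealisesI.alpha_eta {𝔓 : Set FinPartOrd.{u}} (h𝔓 : IsRepSystem 𝔓) {ε : EVHom R S}
    (hε : RealisesI 𝔓 ε) {P : Type u} [PartialOrder P] [Finite P] (ξ : P →o R) (x : P) :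
    alpha (eta ε ξ) x = ε (alpha ξ x) := by
  have := Fintype.ofFinite P
  obtain ⟨P', hP', ⟨e : P ≃o P'⟩⟩ := h𝔓.exists_iso (FinPartOrd.of P) ⟨x⟩
  obtain ⟨ζ, rfl⟩ : ∃ ζ : P' →o R, ξ = ζ.comp (e : P →o P') :=
    ⟨ξ.comp (e.symm : P' →o P), by ext p; simp⟩
  have h : eta ε (ζ.comp (e : P →o P')) = (eta ε ζ).comp (e : P →o P') := by
    ext p
    exact congrArg (fun a => (ε a).pt) (alpha_comp_orderIso e ζ p)
  rw [h, alpha_comp_orderIso, alpha_comp_orderIso]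
  exact hε.2 ⟨P', hP'⟩ ζ (e x)

/-- A realising homomorphism induces a strong I-scheme. -/
theorem RealisesI.strongILE {𝔓 : Set FinPartOrd.{u}} {ε : EVHom R S} (hε : RealisesI 𝔓 ε) :
    StrongILE 𝔓 R S := by
  refine ⟨fun P ξ => eta ε ξ, fun P ξ ζ h => ?_, fun P P' ξ ζ x y => ?_⟩
  · ext x
    -- The map `eta ε ξ` determines its own `alpha`, which is `ε (alpha ξ x)`; injectivity of `ε`
    -- then recovers `ξ x` as a first component.
    have h1 : ε (alpha ξ x) = ε (alpha ζ x) := by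
      rw [← hε.2, ← hε.2]
      exact congrArg (fun θ => alpha θ x) h
    exact congrArg EV.pt (hε.1 h1)
  · rw [hε.2, hε.2]
    exact ⟨fun h => ε.map_rel h, fun h => EVHom.map_lt hε.1 h⟩

end Realisation

/-! ### Restriction to the right summands of ordinal sums -/

section OrdinalSum

theorem inrₗ_injective {Q R : Type*} : Function.Injective (Sum.inrₗ : R → Q ⊕ₗ R) := fun _ _ h =>
  Sum.inr_injective (toLex.injective h)

theorem inlₗ_injective {Q R : Type*} : Function.Injective (Sum.inlₗ : Q → Q ⊕ₗ R) := fun _ _ h =>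
  Sum.inl_injective (toLex.injective h)

theorem eq_inlₗ_or_inrₗ {Q R : Type*} (p : Q ⊕ₗ R) : (∃ y, p = Sum.inlₗ y) ∨ ∃ x, p = Sum.inrₗ x := by
  rcases p with y | x
  · exact Or.inl ⟨y, rfl⟩
  · exact Or.inr ⟨x, rfl⟩

variable {Q P R S : Type*} [PartialOrder Q] [PartialOrder P] [PartialOrder R] [PartialOrder S]

theorem inlₗ_ne_inrₗ (y : Q) (x : R) : (Sum.inlₗ y : Q ⊕ₗ R) ≠ Sum.inrₗ x :=
  (Sum.Lex.inl_lt_inr y x).ne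

/-- The embedding of the right summand into an ordinal sum. -/
def inrEmbedding (Q R : Type*) [PartialOrder Q] [PartialOrder R] : R ↪o Q ⊕ₗ R where
  toFun := Sum.inrₗ
  inj' := inrₗ_injective
  map_rel_iff' := Sum.Lex.inr_le_inr_iff

/-- The ordinal sum of the identity and an order-preserving map. -/
def liftRight (Q : Type*) [PartialOrder Q] (ξ : P →o R) : Q ⊕ₗ P →o Q ⊕ₗ R where
  toFun p := toLex (Sum.map id ξ (ofLex p))
  monotone' := by
    intro a b h
    rcases eq_inlₗ_or_inrₗ a with ⟨a, rfl⟩ | ⟨a, rfl⟩ <;>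
      rcases eq_inlₗ_or_inrₗ b with ⟨b, rfl⟩ | ⟨b, rfl⟩
    · exact Sum.Lex.inl_le_inl_iff.2 (Sum.Lex.inl_le_inl_iff.1 h)
    · exact Sum.Lex.inl_le_inr _ _
    · exact absurd h Sum.Lex.not_inr_le_inl
    · exact Sum.Lex.inr_le_inr_iff.2 (ξ.monotone (Sum.Lex.inr_le_inr_iff.1 h))

theorem extendR_injective : Function.Injective (extendR Q : EV R → EV (Q ⊕ₗ R)) := by
  have key : ∀ (A : Set R) (B : Set R),
      Sum.inrₗ '' A ∪ Set.range (Sum.inlₗ : Q → Q ⊕ₗ R) = Sum.inrₗ '' B ∪ Set.range Sum.inlₗ →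
        A ⊆ B := by
    intro A B h z hz
    have hz' : (Sum.inrₗ z : Q ⊕ₗ R) ∈ Sum.inrₗ '' B ∪ Set.range Sum.inlₗ :=
      h ▸ Or.inl ⟨z, hz, rfl⟩
    rcases hz' with ⟨w, hw, hwz⟩ | ⟨w, hw⟩
    · exact inrₗ_injective hwz ▸ hw
    · exact absurd hw (inlₗ_ne_inrₗ w z)
  intro a b h
  apply EV.ext
  · exact inrₗ_injective (congrArg EV.pt h)
  · exact (key _ _ (congrArg EV.dn h)).antisymm (key _ _ (congrArg EV.dn h).symm)
  · exact inrₗ_injective.image_injective (congrArg EV.up h)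

/-- The points adjoined to the second component come from `Q`, whereas extended triples sit at
points of `R`, so no new relations arise. -/
theorem extendR_lt_iff {a b : EV R} : extendR Q a < extendR Q b ↔ a < b := by
  constructor
  · rintro ⟨⟨x, hx, hxa⟩ | ⟨y, hy⟩, ⟨z, hz, hzb⟩⟩
    · exact ⟨inrₗ_injective hxa ▸ hx, inrₗ_injective hzb ▸ hz⟩
    · exact absurd hy (inlₗ_ne_inrₗ _ _)
  · rintro ⟨h1, h2⟩
    exact ⟨Or.inl ⟨_, h1, rfl⟩, ⟨_, h2, rfl⟩⟩

/-- `restrictS` deletes the `Q`-part of the second component and `extendR` restores all of `Q`, so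
nothing changes if all of `Q` was there. The third component has no `Q`-part, since no point of `Q`
lies above one of `R`. -/
theorem extendR_restrictS
    (a : {a : EV (Q ⊕ₗ R) // a.pt ∈ Set.range (Sum.inrₗ : R → Q ⊕ₗ R)})
    (ha : Set.range Sum.inlₗ ⊆ a.1.dn) : extendR Q (restrictS a) = a.1 := by
  have hpt : (Sum.inrₗ (restrictS a).pt : Q ⊕ₗ R) = a.1.pt := a.2.choose_spec
  apply EV.ext
  · exact hpt
  · ext p
    rcases eq_inlₗ_or_inrₗ p with ⟨y, rfl⟩ | ⟨x, rfl⟩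
    · exact ⟨fun _ => ha ⟨y, rfl⟩, fun _ => Or.inr ⟨y, rfl⟩⟩
    · constructor
      · rintro (⟨z, hz, hzx⟩ | ⟨y, hy⟩)
        · exact hzx ▸ hz
        · exact absurd hy (inlₗ_ne_inrₗ _ _)
      · exact fun h => Or.inl ⟨x, h, rfl⟩
  · ext p
    rcases eq_inlₗ_or_inrₗ p with ⟨y, rfl⟩ | ⟨x, rfl⟩
    · constructor
      · rintro ⟨z, _, hz⟩
        exact absurd hz.symm (inlₗ_ne_inrₗ _ _)
      · intro h
        have h1 := a.1.up_sub h
        rw [← hpt] at h1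
        exact absurd h1 Sum.Lex.not_inr_lt_inl
    · constructor
      · rintro ⟨z, hz, hzx⟩
        exact hzx ▸ hz
      · exact fun h => ⟨x, h, rfl⟩

/-- Elements of `E(Q)*` are smaller than the extensions of the elements of the EV-system
of `R`. -/
theorem starLeft_lt_extendR {a : EV (Q ⊕ₗ R)} (ha : a ∈ starLeft Q R) (b : EV R) :
    a < extendR Q b := by
  obtain ⟨c, h1, -, h3⟩ := ha
  refine ⟨Or.inr ⟨c.pt, h1.symm⟩, ?_⟩
  rw [h3]
  exact Or.inr ⟨b.pt, rfl⟩

/-- The points `α_{Q ⊕ P,θ}(x)`, `x ∈ P`, for a map `θ` which maps `Q` onto `Q` and agrees with `κ`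
on `P`. -/
theorem alpha_inr {θ : Q ⊕ₗ P →o Q ⊕ₗ S} {κ : P →o S} (hr : ∀ p, θ (Sum.inrₗ p) = Sum.inrₗ (κ p))
    (hl : Set.range (fun y : Q => θ (Sum.inlₗ y)) = Set.range Sum.inlₗ) (x : P) :
    alpha θ (Sum.inrₗ x) = extendR Q (alpha κ x) := by
  have hl' : ∀ y : Q, ∃ z : Q, Sum.inlₗ z = θ (Sum.inlₗ y) := fun y => by
    have : θ (Sum.inlₗ y) ∈ Set.range (Sum.inlₗ : Q → Q ⊕ₗ S) := hl ▸ ⟨y, rfl⟩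
    exact this
  -- Points of `Q` are mapped into `Q`, so the fibre through a point of `P` stays inside `P`.
  have hG : fibreComponent θ (Sum.inrₗ x) = Sum.inrₗ '' fibreComponent κ x := by
    refine fibreComponent_image (inrEmbedding Q P) inrₗ_injective hr x fun p' hp' => ?_
    rcases eq_inlₗ_or_inrₗ p' with ⟨y, rfl⟩ | ⟨p, rfl⟩
    · obtain ⟨z, hz⟩ := hl' y
      rw [← hz] at hp'
      exact absurd (hp'.trans (hr x)) (inlₗ_ne_inrₗ _ _)
    · exact ⟨p, rfl⟩
  apply EV.ext
  · exact hr x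
  · ext s
    simp only [alpha, extendR, hG, puncturedDown]
    constructor
    · rintro ⟨p, ⟨⟨_, ⟨a, ha, rfl⟩, hpa⟩, hp⟩, rfl⟩
      rcases eq_inlₗ_or_inrₗ p with ⟨y, rfl⟩ | ⟨p, rfl⟩
      · exact Or.inr (hl' y)
      · refine Or.inl ⟨κ p, ⟨p, ⟨⟨a, ha, Sum.Lex.inr_le_inr_iff.1 hpa⟩, ?_⟩, rfl⟩, (hr p).symm⟩
        exact fun h => hp ⟨p, h, rfl⟩
    · rintro (⟨_, ⟨p, ⟨⟨a, ha, hpa⟩, hp⟩, rfl⟩, rfl⟩ | hs)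
      · refine ⟨Sum.inrₗ p, ⟨⟨_, ⟨a, ha, rfl⟩, Sum.Lex.inr_le_inr_iff.2 hpa⟩, ?_⟩, hr p⟩
        rintro ⟨z, hz, hzp⟩
        exact hp (inrₗ_injective hzp ▸ hz)
      -- Here `θ` has to map `Q` onto all of `Q`, not merely into it.
      · rw [← hl] at hs
        obtain ⟨y, rfl⟩ := hs
        refine ⟨Sum.inlₗ y, ⟨⟨_, ⟨x, self_mem_fibreComponent κ x, rfl⟩, Sum.Lex.inl_le_inr _ _⟩, ?_⟩,
          rfl⟩
        rintro ⟨z, _, hz⟩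
        exact absurd hz.symm (inlₗ_ne_inrₗ _ _)
  · ext s
    simp only [alpha, extendR, hG, puncturedUp]
    constructor
    · rintro ⟨p, ⟨⟨_, ⟨a, ha, rfl⟩, hpa⟩, hp⟩, rfl⟩
      rcases eq_inlₗ_or_inrₗ p with ⟨y, rfl⟩ | ⟨p, rfl⟩
      · exact absurd hpa Sum.Lex.not_inr_le_inl
      · refine ⟨κ p, ⟨p, ⟨⟨a, ha, Sum.Lex.inr_le_inr_iff.1 hpa⟩, ?_⟩, rfl⟩, (hr p).symm⟩
        exact fun h => hp ⟨p, h, rfl⟩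
    · rintro ⟨_, ⟨p, ⟨⟨a, ha, hpa⟩, hp⟩, rfl⟩, rfl⟩
      refine ⟨Sum.inrₗ p, ⟨⟨_, ⟨a, ha, rfl⟩, Sum.Lex.inr_le_inr_iff.2 hpa⟩, ?_⟩, hr p⟩
      rintro ⟨z, hz, hzp⟩
      exact hp (inrₗ_injective hzp ▸ hz)

theorem alpha_liftRight (ξ : P →o R) (x : P) :
    alpha (liftRight Q ξ) (Sum.inrₗ x) = extendR Q (alpha ξ x) :=
  alpha_inr (fun _ => rfl) rfl x

theorem range_inlₗ_subset_dn {ε : EVHom (Q ⊕ₗ R) (Q ⊕ₗ S)} (hinj : Function.Injective ε)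
    (hY : Set.range (Sum.inlₗ : Q → Q ⊕ₗ S) ⊆ (fun a => (ε a).pt) '' starLeft Q R) (b : EV R) :
    Set.range Sum.inlₗ ⊆ (ε (extendR Q b)).dn := by
  intro y hy
  obtain ⟨a, ha, rfl⟩ := hY hy
  exact (EVHom.map_lt hinj (starLeft_lt_extendR ha b)).1

/-- A first component in `Q` would belong to the second component and thus be strictly below itself.
-/
theorem pt_mem_range_inrₗ {a : EV (Q ⊕ₗ R)} (ha : Set.range Sum.inlₗ ⊆ a.dn) :
    a.pt ∈ Set.range (Sum.inrₗ : R → Q ⊕ₗ R) := by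
  rcases eq_inlₗ_or_inrₗ a.pt with ⟨y, hy⟩ | ⟨x, hx⟩
  · exact (lt_irrefl a.pt (a.dn_sub (ha ⟨y, hy.symm⟩))).elim
  · exact ⟨x, hx.symm⟩

/-- The homomorphism `s ∘ ε ∘ r` between the EV-systems of the right summands. -/
noncomputable def restrictHom (ε : EVHom (Q ⊕ₗ R) (Q ⊕ₗ S)) (hinj : Function.Injective ε)
    (hdn : ∀ a : EV R, Set.range Sum.inlₗ ⊆ (ε (extendR Q a)).dn) : EVHom R S where
  toFun a := restrictS ⟨ε (extendR Q a), pt_mem_range_inrₗ (hdn a)⟩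
  map_rel' := by
    rintro a b (h | rfl)
    · left
      rw [← extendR_lt_iff (Q := Q), extendR_restrictS _ (hdn a), extendR_restrictS _ (hdn b)]
      exact EVHom.map_lt hinj (extendR_lt_iff.2 h)
    · exact Or.inr rfl

/-- The identity `r ∘ T = ε ∘ r`, through which properties of `ε` pass to `T`. -/
theorem extendR_restrictHom {ε : EVHom (Q ⊕ₗ R) (Q ⊕ₗ S)} (hinj : Function.Injective ε)
    (hdn : ∀ a : EV R, Set.range Sum.inlₗ ⊆ (ε (extendR Q a)).dn) (a : EV R) :
    extendR Q (restrictHom ε hinj hdn a) = ε (extendR Q a) :=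
  extendR_restrictS _ (hdn a)

theorem restrictHom_injective {ε : EVHom (Q ⊕ₗ R) (Q ⊕ₗ S)} (hinj : Function.Injective ε)
    (hdn : ∀ a : EV R, Set.range Sum.inlₗ ⊆ (ε (extendR Q a)).dn) :
    Function.Injective (restrictHom ε hinj hdn) := fun a b h =>
  extendR_injective (hinj (by rw [← extendR_restrictHom hinj hdn, h, extendR_restrictHom]))

/-- If `ε` satisfies `α(η(ξ)) = ε ∘ α(ξ)` on all ordinal sums of `Q` with `P`, then `s ∘ ε ∘ r`
satisfies it on `P`. -/
theorem alpha_eta_restrictHom [Finite Q] {ε : EVHom (Q ⊕ₗ R) (Q ⊕ₗ S)}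
    (hinj : Function.Injective ε)
    (hdn : ∀ a : EV R, Set.range Sum.inlₗ ⊆ (ε (extendR Q a)).dn)
    (hα : ∀ (ζ : Q ⊕ₗ P →o Q ⊕ₗ R) (z : Q ⊕ₗ P), alpha (eta ε ζ) z = ε (alpha ζ z))
    (ξ : P →o R) (x : P) :
    alpha (eta (restrictHom ε hinj hdn) ξ) x = restrictHom ε hinj hdn (alpha ξ x) := by
  have hr : ∀ p, eta ε (liftRight Q ξ) (Sum.inrₗ p) =
      Sum.inrₗ (eta (restrictHom ε hinj hdn) ξ p) := by
    intro p
    change (ε (alpha (liftRight Q ξ) (Sum.inrₗ p))).pt = _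
    rw [alpha_liftRight, ← extendR_restrictHom hinj hdn]
    rfl
  -- Each point of `Q` lies in the second component of `ε (extendR Q (alpha ξ x))`, which is an
  -- `alpha`, so it is a value of the map. Points of `P` have values in `S`, so a point of `Q`
  -- attains it.
  have hsub : Set.range (Sum.inlₗ : Q → Q ⊕ₗ S) ⊆
      Set.range fun y : Q => eta ε (liftRight Q ξ) (Sum.inlₗ y) := by
    intro y hy
    have h := hdn (alpha ξ x) hy
    rw [← alpha_liftRight, ← hα] at h
    obtain ⟨p, -, rfl⟩ := h
    rcases eq_inlₗ_or_inrₗ p with ⟨z, rfl⟩ | ⟨z, rfl⟩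
    · exact ⟨z, rfl⟩
    · obtain ⟨w, hw⟩ := hy
      exact absurd (hw.trans (hr z)) (inlₗ_ne_inrₗ _ _)
  -- The image of the finite `Q` has at most as many points as `Q`, so containing `Q` it equals `Q`.
  have hl := Set.eq_of_subset_of_ncard_le hsub (by
    rw [Set.ncard_range_of_injective inlₗ_injective, ← Set.image_univ, ← Set.ncard_univ]
    exact Set.ncard_image_le Set.finite_univ) (Set.finite_range _)
  apply extendR_injective (Q := Q)
  rw [← alpha_inr hr hl.symm, hα, alpha_liftRight, extendR_restrictHom]

end OrdinalSum

end HomSchemes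

theorem theorem6 {Q R S : Type u} [PartialOrder Q] [PartialOrder R] [PartialOrder S]
    [Finite Q] [Finite R] [Finite S] [Nonempty Q] [Nonempty R] [Nonempty S]
    (𝔓 : Set FinPartOrd.{u}) (h𝔓 : IsRepSystem 𝔓)
    (ε : EVHom (Q ⊕ₗ R) (Q ⊕ₗ S)) (hε : RealisesI 𝔓 ε)
    (hY : Set.range (Sum.inlₗ : Q → Q ⊕ₗ S) ⊆ (fun a => (ε a).pt) '' starLeft Q R) :
    StrongILE 𝔓 R S ∧
    ∃ (hs : ∀ a : EV R, (ε (extendR Q a)).pt ∈ Set.range (Sum.inrₗ : S → Q ⊕ₗ S))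
      (T : EVHom R S),
      (∀ a : EV R, T a = restrictS ⟨ε (extendR Q a), hs a⟩) ∧ RealisesI 𝔓 T := by
  have hdn := range_inlₗ_subset_dn hε.1 hY
  have hT : RealisesI 𝔓 (restrictHom ε hε.1 hdn) :=
    ⟨restrictHom_injective hε.1 hdn, fun P ξ x =>
      alpha_eta_restrictHom hε.1 hdn
        (fun ζ z => haveI : Finite (Q ⊕ₗ P.1) := inferInstanceAs (Finite (Q ⊕ P.1))
          hε.alpha_eta h𝔓 ζ z) ξ x⟩
  exact ⟨hT.strongILE, fun a => pt_mem_range_inrₗ (hdn a), restrictHom ε hε.1 hdn,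
    fun _ => rfl, hT⟩
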